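/- Let $\kappa_\alpha,\kappa_q,M,a_n,b_n,c_n,d_n,a_m,b_m,c_m,d_m\in\mathbb R$. For $x=(\alpha,q)\in\mathbb R^2$ put $$\phi(x)=\bigl(\kappa_\alpha M(a_n\alpha^2+b_n\alpha+c_n),\ \kappa_qM(a_m\alpha^2+b_m\alpha+c_m)\bigr),$$ and for $\theta\in\mathbb R^2$ put $$A(\theta)=\begin{pmatrix}\theta_1&1\\ \theta_2&0\end{pmatrix},\quad B=\begin{pmatrix}\kappa_\alpha Md_n\\ \kappa_qMd_m\end{pmatrix},\quad C=\begin{pmatrix}1&0\end{pmatrix},\quad \tilde A(\theta)=A(\theta)+BK(\theta)C .$$ Here the gain is $K(\theta)=\varrho_K(\theta,\bar t_\theta)$, where $\eta,\varrho_K\in\mathbb R[\theta_1,\theta_2,t]$ are polynomials and $\bar t_\theta\in\mathbb R$ satisfies $\eta(\theta,\bar t_\theta)=0$ for every $\theta\in\mathcal E$ (defined below). Consider the closed-loop system $$\dot x=\tilde A(\phi(x))\,x, \qquad (1)$$ that is, the missile model with tail fin deflection $\delta=K(\theta)\alpha$, $\theta=\phi(x)$. Let $$\psi(x)=\bigl(\kappa_\alpha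 M(2a_n\alpha+b_n)\,\dot\alpha,\ \kappa_qM(2a_m\alpha+b_m)\,\dot\alpha\bigr),\qquad \dot\alpha=\text{first component of }\tilde A(\phi(x))x,$$ so that $\dot\theta=\psi(x)$ along (1). All norms are Euclidean norms and the induced operator norm. Let $\mathcal D\subset\mathbb R^2$ be a neighbourhood of $0$, $\mathcal E=\phi(\mathcal D)$, $\mathcal F=\psi(\mathcal D)$, and assume that there are $L_A>0$, $m\ge1$, $\lambda>0$ such that 1. $\|\tilde A(\theta)-\tilde A(\theta')\|\le L_A\|\theta-\theta'\|$ for all $\theta,\theta'\in\mathcal E$; 2. for each fixed $\bar\theta\in\mathcal E$, every solution of $\dot x=\tilde A(\bar\theta)x$ satisfies $\|x(t)\|\le m e^{-\lambda t}\|x(0)\|$ for all $t\ge0$; 3. $4L_A\,m\log(m)\,\|\omega\|<\lambda^2$ for all $\omega\in\mathcal F$. For $\theta\in\mathcal E$ let $P(\theta)=\int_0^\infty e^{\tau\tilde A(\theta)^\top}e^{\tau\tilde A(\theta)}\,d\tau$. Call $L_P>0$ *valid* if $\|P(\theta)-P(\theta')\|\le L_P\|\theta-\theta'\|$ for all $\theta,\theta'\in\mathcal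 E$. For valid $L_P$ and $c>0$ let $$\mathcal H=\{x\in\mathcal D:\|\psi(x)\|<L_P^{-1}\},\quad \mathcal W_c(\theta)=\{x\in\mathbb R^2: x^\top P(\theta)x<c\},\quad \mathcal L_c=\bigcap_{\theta\in\mathcal E}\mathcal W_c(\theta),$$ and call $c>0$ *admissible* if $\mathcal W_c(\theta)\subset\mathcal H$ for all $\theta\in\mathcal E$. Call $\mathcal L\subset\mathcal D$ an *estimate of the region of attraction* if it is a neighbourhood of $0$, every solution of (1) starting in $\mathcal L$ stays in $\mathcal D$ as long as it is defined, and there are $k,\mu>0$ such that, from each $x_0\in\mathcal L$, (1) has a solution defined for all $t\ge0$, and every solution from $x_0$ satisfies $\|x(t)\|\le k e^{-\mu t}\|x_0\|$ for all $t\ge0$ at which it is defined. Then: (i) the origin is an exponentially stable equilibrium of (1); (ii) an estimate $\mathcal L\subset\mathcal D$ of the region of attraction exists; (iii) a valid $L_P$ exists, and, for every valid $L_P$ and every admissible $c$, the set $\mathcal L=\mathcal L_c$ is an estimate of the region of attraction; (iv) if $\mathcal D$ is bounded, then for every valid $L_P$ there is a largest admissible $c$. -/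

import Mathlib

open Set Filter Topology MeasureTheory

noncomputable section

namespace Missile

/-- The plane with its Euclidean norm: states `x = (α, q)` and parameters `θ = (θ₁, θ₂)`. -/
abbrev Plane : Type := EuclideanSpace ℝ (Fin 2)

/-- The known coefficients of the missile model (`M` is the Mach number). -/
structure Coeffs where
  (kα kq M an bn cn dn am bm cm dm : ℝ)

/-- The gain `K(θ) = ϱ(θ, t̄_θ)`, for a polynomial `ϱ ∈ ℝ[θ₁, θ₂, t]` and a selection `θ ↦ t̄_θ`. -/
def gain (ϱ : MvPolynomial (Fin 3) ℝ) (tbar : Plane → ℝ) (θ : Plane) : ℝ :=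
  MvPolynomial.eval ![θ 0, θ 1, tbar θ] ϱ

/-- The parameter as a function of the state, `θ = (φ₁(x), φ₂(x))`. -/
def phi (p : Coeffs) (x : Plane) : Plane :=
  !₂[p.kα * p.M * (p.an * x 0 ^ 2 + p.bn * x 0 + p.cn),
     p.kq * p.M * (p.am * x 0 ^ 2 + p.bm * x 0 + p.cm)]

/-- `A(θ)`. -/
def matA (θ : Plane) : Matrix (Fin 2) (Fin 2) ℝ := !![θ 0, 1; θ 1, 0]

/-- `B`. -/
def matB (p : Coeffs) : Matrix (Fin 2) (Fin 1) ℝ := !![p.kα * p.M * p.dn; p.kq * p.M * p.dm]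

/-- `C`. -/
def matC : Matrix (Fin 1) (Fin 2) ℝ := !![1, 0]

/-- The closed-loop dynamic matrix `Ã(θ) = A(θ) + B K(θ) C`. -/
def matAcl (p : Coeffs) (K : Plane → ℝ) (θ : Plane) : Matrix (Fin 2) (Fin 2) ℝ :=
  matA θ + K θ • (matB p * matC)

/-- `Ã(θ)` as an operator on the Euclidean plane, so that `‖·‖` is the induced 2-norm. -/
def Acl (p : Coeffs) (K : Plane → ℝ) (θ : Plane) : Plane →L[ℝ] Plane :=
  Matrix.toEuclideanCLM (n := Fin 2) (𝕜 := ℝ) (matAcl p K θ)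

/-- The closed-loop vector field `x ↦ Ã(θ) x` with `θ = φ(x)`. -/
def closedLoop (p : Coeffs) (K : Plane → ℝ) (x : Plane) : Plane := Acl p K (phi p x) x

/-- `α̇` along the missile model with `δ = K(θ) α`. -/
def alphaDot (p : Coeffs) (K : Plane → ℝ) (x : Plane) : ℝ :=
  p.kα * p.M * ((p.an * x 0 ^ 2 + p.bn * x 0 + p.cn) * x 0 + p.dn * (K (phi p x) * x 0)) + x 1

/-- The time derivative of the parameter as a function of the state, `θ̇ = (ψ₁(x), ψ₂(x))`. -/
def psi (p : Coeffs) (K : Plane → ℝ) (x : Plane) : Plane :=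
  !₂[p.kα * p.M * (2 * p.an * x 0 + p.bn) * alphaDot p K x,
     p.kq * p.M * (2 * p.am * x 0 + p.bm) * alphaDot p K x]

/-- `𝓔`: the parameter values attained on `D`. -/
def paramSet (p : Coeffs) (D : Set Plane) : Set Plane := {θ | ∃ x ∈ D, θ = phi p x}

/-- `𝓕`: the parameter velocities attained on `D`. -/
def velocitySet (p : Coeffs) (K : Plane → ℝ) (D : Set Plane) : Set Plane :=
  {ω | ∃ x ∈ D, ω = psi p K x}

/-- `x` is a (classical) solution of `ẋ = f(x)` on the time interval `I`. -/
def IsSolutionOn (f : Plane → Plane) (x : ℝ → Plane) (I : Set ℝ) : Prop :=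
  ∀ t ∈ I, HasDerivWithinAt x (f (x t)) I t

/-- Every frozen system `ẋ = Ã(θ) x`, with `θ ∈ 𝓔` constant, satisfies
`‖x(t)‖ ≤ m e^{-lam t} ‖x(0)‖` for all `t ≥ 0`. -/
def FrozenExpBound (p : Coeffs) (K : Plane → ℝ) (D : Set Plane) (m lam : ℝ) : Prop :=
  ∀ θ ∈ paramSet p D, ∀ x : ℝ → Plane, IsSolutionOn (fun y => Acl p K θ y) x (Ici 0) →
    ∀ t : ℝ, 0 ≤ t → ‖x t‖ ≤ m * Real.exp (-lam * t) * ‖x 0‖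

/-- From every initial state in `S` there is a solution for all `t ≥ 0`, and every solution
from there, on whatever interval `[0, T)` it is defined, obeys one common exponential bound. -/
def ExpConvergesFrom (f : Plane → Plane) (S : Set Plane) : Prop :=
  ∃ c > 0, ∃ μ > 0, ∀ x₀ ∈ S,
    (∃ x : ℝ → Plane, IsSolutionOn f x (Ici 0) ∧ x 0 = x₀) ∧
    ∀ (T : ℝ) (x : ℝ → Plane), IsSolutionOn f x (Ico 0 T) → x 0 = x₀ →
      ∀ t ∈ Ico 0 T, ‖x t‖ ≤ c * Real.exp (-μ * t) * ‖x₀‖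

/-- The origin is an exponentially stable equilibrium of `ẋ = f(x)`. -/
def ExpStableAtZero (f : Plane → Plane) : Prop :=
  f 0 = 0 ∧ ∃ S ∈ 𝓝 (0 : Plane), ExpConvergesFrom f S

/-- `L ⊆ D` is a neighbourhood of the origin, trajectories starting in `L` stay in `D`, and they
exist for all times and converge to the origin exponentially (so that `L` lies in the domain of
attraction). -/
structure IsAttractionEstimate (f : Plane → Plane) (D L : Set Plane) : Prop where
  subset : L ⊆ D
  mem_nhds : L ∈ 𝓝 (0 : Plane)
  stays : ∀ (T : ℝ) (x : ℝ → Plane), IsSolutionOn f x (Ico 0 T) → x 0 ∈ L →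
    ∀ t ∈ Ico 0 T, x t ∈ D
  converges : ExpConvergesFrom f L

/-- `P(θ) = ∫₀^∞ e^{τ Ã(θ)ᵀ} e^{τ Ã(θ)} dτ`. -/
def lyapP (p : Coeffs) (K : Plane → ℝ) (θ : Plane) : Plane →L[ℝ] Plane :=
  ∫ τ in Ioi (0 : ℝ),
    NormedSpace.exp (τ • (Acl p K θ).adjoint) * NormedSpace.exp (τ • Acl p K θ)

/-- `LP > 0` is a Lipschitz constant of `P` on `𝓔`. -/
def IsLipConstP (p : Coeffs) (K : Plane → ℝ) (D : Set Plane) (LP : ℝ) : Prop :=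
  0 < LP ∧ ∀ θ ∈ paramSet p D, ∀ θ' ∈ paramSet p D,
    ‖lyapP p K θ - lyapP p K θ'‖ ≤ LP * ‖θ - θ'‖

/-- `𝓗 = {x ∈ D : ‖ψ(x)‖ < LP⁻¹}`. -/
def setH (p : Coeffs) (K : Plane → ℝ) (D : Set Plane) (LP : ℝ) : Set Plane :=
  {x ∈ D | ‖psi p K x‖ < LP⁻¹}

/-- `𝓦(θ) = {x : xᵀ P(θ) x < c}`. -/
def setW (p : Coeffs) (K : Plane → ℝ) (c : ℝ) (θ : Plane) : Set Plane :=
  {x | inner ℝ x (lyapP p K θ x) < c}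

/-- The levels `c > 0` such that `𝓦(θ) ⊆ 𝓗` for all `θ ∈ 𝓔`. -/
def admissibleLevels (p : Coeffs) (K : Plane → ℝ) (D : Set Plane) (LP : ℝ) : Set ℝ :=
  {c | 0 < c ∧ ∀ θ ∈ paramSet p D, setW p K c θ ⊆ setH p K D LP}

/-- `𝓛 = ⋂_{θ ∈ 𝓔} 𝓦(θ)`. -/
def setL (p : Coeffs) (K : Plane → ℝ) (D : Set Plane) (c : ℝ) : Set Plane :=
  ⋂ θ ∈ paramSet p D, setW p K c θ

end Missile

end

/-!
The closed loop `ẋ = Ã(φ(x)) x` is a linear system with a parameter `θ = φ(x)` that varies slowly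
along trajectories, and every frozen system decays like `m e^{-lam t}`. Two independent mechanisms
are combined.

*Decay inside `D`* (`SlowlyVarying.norm_le_of_mem`). The lower right entry of `Ã(θ)` vanishes, so
`m = 1` is impossible (`SlowlyVarying.one_lt`) and the slow variation hypothesis bounds `‖θ̇‖`
uniformly by `lam² / (4 LA m log m)`. On a time window of length `4 log m / lam` the parameter is
frozen at the midpoint; variation of constants gives the rate `lam / 2` there, which suffices to
beat the overshoot `m` over a full window (`norm_le_of_slowly_varying`). Hence a trajectory obeys
`‖x(t)‖ ≤ m e^{-lam t / 4} ‖x(0)‖` as long as it remains in `D`. The constants do not depend on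
`L_P` or `c`; this matters because `L_P ‖ψ(x)‖ < 1` on `𝓗` need not be bounded away from `1`, so
that the Lyapunov function alone gives no uniform rate.

*Invariance* (`SlowlyVarying.invariance`). With the Lyapunov equation `Ã(θ)ᵀ P(θ) + P(θ) Ã(θ) = -1`
the function `V(x) = xᵀ P(φ(x)) x` satisfies `V̇ ≤ -(1 - L_P ‖ψ(x)‖) ‖x‖² ≤ 0` on `𝓗`, in the sense
of Dini derivatives since `P` is merely Lipschitz on `𝓔`. A trajectory starting in `𝓛_c` has
`V < c` initially; as long as `V(x) < c` the state lies in the open set `𝓦_c(φ(x)) ⊆ 𝓗 ⊆ D`, so the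
trajectory cannot leave `D` immediately, and a limit point of such states lies in `D` again
(`SlowlyVarying.isClosed_lyapV_le`), although `D` is assumed neither open nor closed. Global
existence follows by extending the closed-loop field from a bounded part of `D` to a bounded
Lipschitz field on the plane (`SlowlyVarying.exists_solution`).

On a bounded domain `Ã` is bounded on `𝓔`, so the `P(θ)` are uniformly coercive
(`le_inner_lyapOp_self`) and admissible levels exist; they are bounded above because `P(θ)` is
bounded, and their supremum is admissible. An estimate for a general `D` is obtained by intersecting
`D` with a ball first.
-/

namespace Missile

section Operators

variable {X : Type*} [NormedAddCommGroup X]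

/-- The semigroup generated by `A` decays like `m e^{-lam t}` in operator norm. -/
def ExpBound [NormedSpace ℝ X] (A : X →L[ℝ] X) (m lam : ℝ) : Prop :=
  ∀ t : ℝ, 0 ≤ t → ‖NormedSpace.exp (t • A)‖ ≤ m * Real.exp (-lam * t)

/-! ### Perturbation of operator exponentials -/

theorem hasDerivAt_exp_sub_smul [NormedSpace ℝ X] [CompleteSpace X] (A : X →L[ℝ] X) (t s : ℝ) :
    HasDerivAt (fun u : ℝ => NormedSpace.exp ((t - u) • A))
      (-(NormedSpace.exp ((t - s) • A) * A)) s := by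
  have h := (hasDerivAt_exp_smul_const A (t - s)).scomp s ((hasDerivAt_id s).const_sub t)
  rw [neg_one_smul] at h
  exact h

theorem exp_zero_smul [NormedSpace ℝ X] (A : X →L[ℝ] X) :
    NormedSpace.exp ((0 : ℝ) • A) = 1 := by simp

/-- Two exponentially bounded semigroups differ at most linearly in their generators: compare
them along the path `s ↦ e^{(t - s) A} e^{s B}`. -/
theorem norm_exp_smul_sub_le [NormedSpace ℝ X] [CompleteSpace X] {A B : X →L[ℝ] X} {m lam : ℝ}
    (hA : ExpBound A m lam) (hB : ExpBound B m lam) {t : ℝ} (ht : 0 ≤ t) :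
    ‖NormedSpace.exp (t • A) - NormedSpace.exp (t • B)‖ ≤
      m ^ 2 * Real.exp (-lam * t) * ‖A - B‖ * t := by
  set G : ℝ → X →L[ℝ] X := fun s => NormedSpace.exp ((t - s) • A) * NormedSpace.exp (s • B)
  have hG : ∀ s, HasDerivAt G
      (NormedSpace.exp ((t - s) • A) * (B - A) * NormedSpace.exp (s • B)) s := by
    intro s
    have h := (hasDerivAt_exp_sub_smul A t s).mul (hasDerivAt_exp_smul_const' B s)
    refine h.congr_deriv ?_
    noncomm_ring
  have hb : ∀ s ∈ Ico 0 t,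
      ‖NormedSpace.exp ((t - s) • A) * (B - A) * NormedSpace.exp (s • B)‖ ≤
        m ^ 2 * Real.exp (-lam * t) * ‖A - B‖ := by
    intro s hs
    have h1 := hA (t - s) (by linarith [hs.2])
    have h2 := hB s hs.1
    have he : Real.exp (-lam * t) = Real.exp (-lam * (t - s)) * Real.exp (-lam * s) := by
      rw [← Real.exp_add]; ring_nf
    calc _ ≤ ‖NormedSpace.exp ((t - s) • A)‖ * ‖B - A‖ * ‖NormedSpace.exp (s • B)‖ :=
          (norm_mul_le _ _).trans (by gcongr; exact norm_mul_le _ _)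
      _ ≤ (m * Real.exp (-lam * (t - s))) * ‖B - A‖ * (m * Real.exp (-lam * s)) := by
          gcongr
          exact mul_nonneg ((norm_nonneg _).trans h1) (norm_nonneg _)
      _ = _ := by rw [he, norm_sub_rev B A]; ring
  have := norm_image_sub_le_of_norm_deriv_le_segment' (f := G)
    (fun s _ => (hG s).hasDerivWithinAt) hb t (right_mem_Icc.2 ht)
  rw [norm_sub_rev]
  simpa [G] using this

/-! ### The Lyapunov operator -/

variable [InnerProductSpace ℝ X] [CompleteSpace X]

/-- `∫₀^∞ e^{τ A†} e^{τ A} dτ`, the solution `P` of the Lyapunov equation `A† P + P A = -1` for an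
exponentially stable `A`. -/
noncomputable def lyapOp (A : X →L[ℝ] X) : X →L[ℝ] X :=
  ∫ τ in Ioi (0 : ℝ), NormedSpace.exp (τ • A.adjoint) * NormedSpace.exp (τ • A)

theorem exp_smul_adjoint (A : X →L[ℝ] X) (t : ℝ) :
    NormedSpace.exp (t • A.adjoint) = star (NormedSpace.exp (t • A)) := by
  rw [NormedSpace.star_exp, star_smul, ContinuousLinearMap.star_eq_adjoint, star_trivial]

theorem continuous_exp_smul (A : X →L[ℝ] X) :
    Continuous fun t : ℝ => NormedSpace.exp (t • A) :=
  continuous_iff_continuousAt.2 fun t => (hasDerivAt_exp_smul_const A t).continuousAt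

theorem norm_lyapIntegrand_le {A : X →L[ℝ] X} {m lam : ℝ} (hA : ExpBound A m lam) {t : ℝ}
    (ht : 0 ≤ t) :
    ‖NormedSpace.exp (t • A.adjoint) * NormedSpace.exp (t • A)‖ ≤
      m ^ 2 * Real.exp (-(2 * lam) * t) := by
  rw [exp_smul_adjoint]
  have h := hA t ht
  calc _ = ‖NormedSpace.exp (t • A)‖ * ‖NormedSpace.exp (t • A)‖ := CStarRing.norm_star_mul_self
    _ ≤ (m * Real.exp (-lam * t)) * (m * Real.exp (-lam * t)) := by
        gcongr
        exact (norm_nonneg _).trans h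
    _ = m ^ 2 * (Real.exp (-lam * t) * Real.exp (-lam * t)) := by ring
    _ = _ := by rw [← Real.exp_add]; ring_nf

theorem integrableOn_lyapIntegrand {A : X →L[ℝ] X} {m lam : ℝ} (hlam : 0 < lam)
    (hA : ExpBound A m lam) :
    IntegrableOn (fun t : ℝ => NormedSpace.exp (t • A.adjoint) * NormedSpace.exp (t • A))
      (Ioi 0) := by
  refine Integrable.mono' ((exp_neg_integrableOn_Ioi 0 (b := 2 * lam) (by positivity)).const_mul
    (m ^ 2)) ?_ ?_
  · exact ((continuous_exp_smul _).mul (continuous_exp_smul _)).aestronglyMeasurable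
  · exact (ae_restrict_mem measurableSet_Ioi).mono fun t ht => norm_lyapIntegrand_le hA (le_of_lt ht)

theorem norm_lyapOp_le {A : X →L[ℝ] X} {m lam : ℝ} (hlam : 0 < lam) (hA : ExpBound A m lam) :
    ‖lyapOp A‖ ≤ m ^ 2 / (2 * lam) := by
  refine (norm_integral_le_of_norm_le
    ((exp_neg_integrableOn_Ioi 0 (b := 2 * lam) (by positivity)).const_mul (m ^ 2))
    ((ae_restrict_mem measurableSet_Ioi).mono
      fun t ht => norm_lyapIntegrand_le hA (le_of_lt ht))).trans_eq ?_
  rw [integral_const_mul, integral_exp_mul_Ioi (by linarith)]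
  simp [div_eq_mul_inv]

theorem inner_lyapOp_self_nonneg {A : X →L[ℝ] X} {m lam : ℝ} (hlam : 0 < lam)
    (hA : ExpBound A m lam) (x : X) : 0 ≤ inner ℝ x (lyapOp A x) := by
  have hi := integrableOn_lyapIntegrand hlam hA
  rw [lyapOp, ContinuousLinearMap.integral_apply hi, ← integral_inner (hi.apply_continuousLinearMap x)]
  refine integral_nonneg fun t => ?_
  simp only [Pi.zero_apply]
  rw [exp_smul_adjoint, ContinuousLinearMap.star_eq_adjoint, mul_apply_eq_comp,
    ContinuousLinearMap.adjoint_inner_right]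
  exact real_inner_self_nonneg

theorem inner_lyapOp_self_le {A : X →L[ℝ] X} {m lam : ℝ} (hlam : 0 < lam)
    (hA : ExpBound A m lam) (x : X) : inner ℝ x (lyapOp A x) ≤ m ^ 2 / (2 * lam) * ‖x‖ ^ 2 := by
  calc _ ≤ ‖x‖ * (‖lyapOp A‖ * ‖x‖) :=
        (real_inner_le_norm _ _).trans (by gcongr; exact (lyapOp A).le_opNorm x)
    _ = ‖lyapOp A‖ * ‖x‖ ^ 2 := by ring
    _ ≤ _ := by gcongr; exact norm_lyapOp_le hlam hA

theorem tendsto_lyapIntegrand {A : X →L[ℝ] X} {m lam : ℝ} (hlam : 0 < lam)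
    (hA : ExpBound A m lam) :
    Tendsto (fun t : ℝ => NormedSpace.exp (t • A.adjoint) * NormedSpace.exp (t • A)) atTop
      (𝓝 0) := by
  have h1 : Tendsto (fun t : ℝ => m ^ 2 * Real.exp (-(2 * lam) * t)) atTop (𝓝 (m ^ 2 * 0)) :=
    (Real.tendsto_exp_atBot.comp
      (tendsto_id.const_mul_atTop_of_neg (by linarith : -(2 * lam) < 0))).const_mul _
  rw [mul_zero] at h1
  exact squeeze_zero_norm' ((eventually_ge_atTop 0).mono fun t ht => norm_lyapIntegrand_le hA ht) h1

/-- The Lyapunov equation: integrate the derivative of `e^{τ A†} e^{τ A}` over `[0, ∞)`. -/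
theorem lyapunov_equation {A : X →L[ℝ] X} {m lam : ℝ} (hlam : 0 < lam) (hA : ExpBound A m lam) :
    A.adjoint * lyapOp A + lyapOp A * A = -1 := by
  have hi := integrableOn_lyapIntegrand hlam hA
  have hd : ∀ t ∈ Ici (0 : ℝ), HasDerivAt
      (fun t : ℝ => NormedSpace.exp (t • A.adjoint) * NormedSpace.exp (t • A))
      (A.adjoint * (NormedSpace.exp (t • A.adjoint) * NormedSpace.exp (t • A)) +
        (NormedSpace.exp (t • A.adjoint) * NormedSpace.exp (t • A)) * A) t := by
    intro t _
    have h := (hasDerivAt_exp_smul_const' A.adjoint t).mul (hasDerivAt_exp_smul_const A t)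
    refine h.congr_deriv ?_
    noncomm_ring
  have h1 := Integrable.const_mul hi A.adjoint
  have h2 := Integrable.mul_const hi A
  have h := integral_Ioi_of_hasDerivAt_of_tendsto' hd (h1.add h2) (tendsto_lyapIntegrand hlam hA)
  rw [integral_add h1 h2, integral_const_mul_of_integrable hi,
    integral_mul_const_of_integrable hi] at h
  simpa [lyapOp] using h

theorem inner_lyapunov_equation {A : X →L[ℝ] X} {m lam : ℝ} (hlam : 0 < lam)
    (hA : ExpBound A m lam) (x : X) :
    inner ℝ (A x) (lyapOp A x) + inner ℝ x (lyapOp A (A x)) = -‖x‖ ^ 2 := by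
  have h := congrArg (fun T : X →L[ℝ] X => inner ℝ x (T x)) (lyapunov_equation hlam hA)
  simp only [add_apply, mul_apply_eq_comp, inner_add_right,
    ContinuousLinearMap.adjoint_inner_right, neg_apply, inner_neg_right,
    one_apply_eq_self, real_inner_self_eq_norm_sq] at h
  exact h

/-- Coercivity of the Lyapunov operator of a bounded `A`: the quadratic form is nonnegative at
`x + s A x`, and the Lyapunov equation evaluates its linear term in `s`. -/
theorem le_inner_lyapOp_self {A : X →L[ℝ] X} {m lam a : ℝ} (hlam : 0 < lam)
    (hA : ExpBound A m lam) (hm : 0 < m) (ha : 0 < a) (hAa : ‖A‖ ≤ a) (x : X) :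
    lam / (2 * a ^ 2 * m ^ 2) * ‖x‖ ^ 2 ≤ inner ℝ x (lyapOp A x) := by
  -- `s` minimises `-s + s² a² m² / (2 lam)`
  set s : ℝ := lam / (a ^ 2 * m ^ 2) with hs
  have h0 := inner_lyapOp_self_nonneg hlam hA (x + s • A x)
  have h1 := inner_lyapunov_equation hlam hA x
  have h2 := inner_lyapOp_self_le hlam hA (A x)
  have h3 : ‖A x‖ ^ 2 ≤ a ^ 2 * ‖x‖ ^ 2 := by
    rw [← mul_pow]
    have := A.le_of_opNorm_le hAa x
    gcongr
  have h4 : inner ℝ (A x) (lyapOp A (A x)) ≤ m ^ 2 / (2 * lam) * (a ^ 2 * ‖x‖ ^ 2) :=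
    h2.trans (by gcongr)
  simp only [map_add, map_smul, inner_add_left, inner_add_right, real_inner_smul_left,
    real_inner_smul_right] at h0
  have h5 : s * (s * inner ℝ (A x) (lyapOp A (A x))) ≤
      s * (s * (m ^ 2 / (2 * lam) * (a ^ 2 * ‖x‖ ^ 2))) := by
    have : 0 < s := by positivity
    gcongr
  have h6 : s * (s * (m ^ 2 / (2 * lam) * (a ^ 2 * ‖x‖ ^ 2))) = s / 2 * ‖x‖ ^ 2 := by
    rw [hs]; field_simp
  have h7 : lam / (2 * a ^ 2 * m ^ 2) = s / 2 := by rw [hs]; field_simp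
  rw [h7]
  have h8 : s * inner ℝ (A x) (lyapOp A x) + s * inner ℝ x (lyapOp A (A x)) = - s * ‖x‖ ^ 2 := by
    rw [← mul_add, h1]; ring
  linarith

/-- The Lyapunov operator depends Lipschitz continuously on the generator. -/
theorem norm_lyapOp_sub_le {A B : X →L[ℝ] X} {m lam : ℝ} (hlam : 0 < lam) (hm : 0 ≤ m)
    (hA : ExpBound A m lam) (hB : ExpBound B m lam) :
    ‖lyapOp A - lyapOp B‖ ≤ 2 * m ^ 3 / lam ^ 2 * ‖A - B‖ := by
  rw [lyapOp, lyapOp, ← integral_sub (integrableOn_lyapIntegrand hlam hA)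
    (integrableOn_lyapIntegrand hlam hB)]
  refine (norm_integral_le_of_norm_le
    ((exp_neg_integrableOn_Ioi 0 (b := lam) hlam).const_mul (2 * m ^ 3 / lam * ‖A - B‖))
    ((ae_restrict_mem measurableSet_Ioi).mono fun t ht => ?_)).trans_eq ?_
  · have ht0 : 0 ≤ t := le_of_lt ht
    set E := NormedSpace.exp (t • A)
    set F := NormedSpace.exp (t • B)
    have hE : ‖E‖ ≤ m * Real.exp (-lam * t) := hA t ht0
    have hF : ‖F‖ ≤ m * Real.exp (-lam * t) := hB t ht0
    have hEF : ‖E - F‖ ≤ m ^ 2 * Real.exp (-lam * t) * ‖A - B‖ * t := norm_exp_smul_sub_le hA hB ht0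
    rw [exp_smul_adjoint, exp_smul_adjoint]
    have hsplit : star E * E - star F * F = star E * (E - F) + star (E - F) * F := by
      rw [star_sub]; noncomm_ring
    have hstar : ∀ T : X →L[ℝ] X, ‖star T‖ = ‖T‖ := fun T =>
      (ContinuousLinearMap.adjoint (𝕜 := ℝ) (E := X) (F := X)).norm_map T
    -- half of the decay rate absorbs the factor `t`
    have hexp : lam * t * Real.exp (-lam * t) ≤ 1 := by
      have h1 : lam * t ≤ Real.exp (lam * t) := by linarith [Real.add_one_le_exp (lam * t)]
      calc _ ≤ Real.exp (lam * t) * Real.exp (-lam * t) := by gcongr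
        _ = 1 := by rw [← Real.exp_add]; simp
    calc ‖star E * E - star F * F‖ ≤ ‖E‖ * ‖E - F‖ + ‖E - F‖ * ‖F‖ := by
          rw [hsplit]
          refine (norm_add_le _ _).trans ?_
          gcongr
          · exact (norm_mul_le _ _).trans_eq (by rw [hstar])
          · exact (norm_mul_le _ _).trans_eq (by rw [hstar])
      _ = ‖E - F‖ * (‖E‖ + ‖F‖) := by ring
      _ ≤ (m ^ 2 * Real.exp (-lam * t) * ‖A - B‖ * t) *
            (m * Real.exp (-lam * t) + m * Real.exp (-lam * t)) := by gcongr
      _ = (2 * m ^ 3 / lam * ‖A - B‖ * Real.exp (-lam * t)) *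
            (lam * t * Real.exp (-lam * t)) := by field_simp; ring
      _ ≤ (2 * m ^ 3 / lam * ‖A - B‖ * Real.exp (-lam * t)) * 1 := by gcongr
      _ = _ := by ring
  · rw [integral_const_mul, integral_exp_mul_Ioi (by linarith)]
    simp only [mul_zero, Real.exp_zero]
    field_simp

end Operators

section SlowVariation

/-! ### Slowly varying linear systems -/

variable {X : Type*} [NormedAddCommGroup X] [NormedSpace ℝ X] [CompleteSpace X]

/-- If `‖x s‖ ≤ C e^{(-lam + m δ)(s - a)}` up to time `t`, then variation of constants reproduces
this bound at time `t` with the slack `C - m ‖x a‖`. -/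
theorem norm_le_of_forall_norm_le {A : X →L[ℝ] X} {m lam δ a b C : ℝ} (hA : ExpBound A m lam)
    (hm : 0 ≤ m) {x x' : ℝ → X} (hx : ∀ t ∈ Icc a b, HasDerivWithinAt x (x' t) (Icc a b) t)
    (hδ : 0 ≤ δ) (hd : ∀ t ∈ Icc a b, ‖x' t - A (x t)‖ ≤ δ * ‖x t‖) {t : ℝ} (ht : t ∈ Icc a b)
    (hC : ∀ s ∈ Icc a t, ‖x s‖ ≤ C * Real.exp ((-lam + m * δ) * (s - a))) :
    ‖x t‖ ≤ C * Real.exp ((-lam + m * δ) * (t - a)) -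
      (C - m * ‖x a‖) * Real.exp (-lam * (t - a)) := by
  set y : ℝ → X := fun s =>
    NormedSpace.exp ((t - s) • A) (x s) - NormedSpace.exp ((t - a) • A) (x a) with hy
  set B : ℝ → ℝ := fun s => C * Real.exp (-lam * (t - a)) * (Real.exp (m * δ * (s - a)) - 1) with hB
  have hyd : ∀ s ∈ Icc a t,
      HasDerivWithinAt y (NormedSpace.exp ((t - s) • A) (x' s - A (x s))) (Icc a t) s := by
    intro s hs
    have h1 := (hx s ⟨hs.1, hs.2.trans ht.2⟩).mono (Icc_subset_Icc_right ht.2)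
    have h2 := ((hasDerivAt_exp_sub_smul A t s).hasDerivWithinAt (s := Icc a t)).clm_apply h1
    refine (h2.sub_const _).congr_deriv ?_
    simp [mul_apply_eq_comp, sub_eq_neg_add]
  have hBd : ∀ s, HasDerivAt B
      (C * Real.exp (-lam * (t - a)) * (Real.exp (m * δ * (s - a)) * (m * δ))) s := by
    intro s
    have h := (((hasDerivAt_id s).sub_const a).const_mul (m * δ)).exp.sub_const 1
    simpa [hB] using h.const_mul (C * Real.exp (-lam * (t - a)))
  have key := image_norm_le_of_norm_deriv_right_le_deriv_boundary (f := y) (a := a) (b := t)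
    (f' := fun s => NormedSpace.exp ((t - s) • A) (x' s - A (x s))) (B := B)
    (B' := fun s => C * Real.exp (-lam * (t - a)) * (Real.exp (m * δ * (s - a)) * (m * δ)))
    (fun s hs => (hyd s hs).continuousWithinAt)
    (fun s hs => (hyd s (Ico_subset_Icc_self hs)).mono_of_mem_nhdsWithin
      (Icc_mem_nhdsGE_of_mem hs))
    (by simp [hy, hB]) hBd ?_ (right_mem_Icc.2 ht.1)
  · have hxt : x t = y t + NormedSpace.exp ((t - a) • A) (x a) := by simp [hy]
    have h3 : ‖NormedSpace.exp ((t - a) • A) (x a)‖ ≤ m * Real.exp (-lam * (t - a)) * ‖x a‖ :=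
      (NormedSpace.exp ((t - a) • A)).le_of_opNorm_le (hA _ (by linarith [ht.1])) _
    have h4 : Real.exp ((-lam + m * δ) * (t - a)) =
        Real.exp (-lam * (t - a)) * Real.exp (m * δ * (t - a)) := by
      rw [← Real.exp_add]; ring_nf
    calc ‖x t‖ ≤ ‖y t‖ + ‖NormedSpace.exp ((t - a) • A) (x a)‖ := by
          rw [hxt]; exact norm_add_le _ _
      _ ≤ B t + m * Real.exp (-lam * (t - a)) * ‖x a‖ := add_le_add key h3
      _ = _ := by rw [h4, hB]; ring
  · intro s hs
    have hs' : s ∈ Icc a b := ⟨hs.1, hs.2.le.trans ht.2⟩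
    have h5 : Real.exp (-lam * (t - s)) * Real.exp ((-lam + m * δ) * (s - a)) =
        Real.exp (-lam * (t - a)) * Real.exp (m * δ * (s - a)) := by
      rw [← Real.exp_add, ← Real.exp_add]; ring_nf
    calc ‖NormedSpace.exp ((t - s) • A) (x' s - A (x s))‖
        ≤ (m * Real.exp (-lam * (t - s))) * ‖x' s - A (x s)‖ :=
          (NormedSpace.exp ((t - s) • A)).le_of_opNorm_le (hA _ (by linarith [hs.2])) _
      _ ≤ (m * Real.exp (-lam * (t - s))) *
            (δ * (C * Real.exp ((-lam + m * δ) * (s - a)))) := by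
          gcongr
          exact (hd s hs').trans (by gcongr; exact hC s (Ico_subset_Icc_self hs))
      _ = m * δ * C *
            (Real.exp (-lam * (t - s)) * Real.exp ((-lam + m * δ) * (s - a))) := by ring
      _ = _ := by rw [h5]; ring

/-- A curve whose velocity differs from `A x` by at most `δ ‖x‖` decays with the rate of `A`
lowered by `m δ`. -/
theorem norm_le_of_norm_deriv_sub_le {A : X →L[ℝ] X} {m lam δ a b : ℝ} (hA : ExpBound A m lam)
    (hm : 1 ≤ m) {x x' : ℝ → X} (hab : a ≤ b)
    (hx : ∀ t ∈ Icc a b, HasDerivWithinAt x (x' t) (Icc a b) t)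
    (hδ : 0 ≤ δ) (hd : ∀ t ∈ Icc a b, ‖x' t - A (x t)‖ ≤ δ * ‖x t‖) :
    ‖x b‖ ≤ m * Real.exp ((-lam + m * δ) * (b - a)) * ‖x a‖ := by
  have hcont : ContinuousOn x (Icc a b) := fun t ht => (hx t ht).continuousWithinAt
  have key : ∀ C, m * ‖x a‖ < C → ‖x b‖ ≤ C * Real.exp ((-lam + m * δ) * (b - a)) := by
    intro C hC
    have hsub : Icc a b ⊆ {t | ‖x t‖ ≤ C * Real.exp ((-lam + m * δ) * (t - a))} := by
      have hcE : Continuous fun t : ℝ => C * Real.exp ((-lam + m * δ) * (t - a)) := by fun_prop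
      refine IsClosed.Icc_subset_of_forall_mem_nhdsGT_of_Icc_subset ?_ ?_ ?_
      · rw [inter_comm]
        exact isClosed_Icc.isClosed_le hcont.norm hcE.continuousOn
      · have : ‖x a‖ ≤ m * ‖x a‖ := le_mul_of_one_le_left (norm_nonneg _) hm
        simpa using this.trans hC.le
      · intro t ht hsub
        have h1 := norm_le_of_forall_norm_le hA (zero_le_one.trans hm) hx hδ hd
          (Ico_subset_Icc_self ht) hsub
        have hlt : ‖x t‖ < C * Real.exp ((-lam + m * δ) * (t - a)) := by
          have : 0 < (C - m * ‖x a‖) * Real.exp (-lam * (t - a)) :=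
            mul_pos (sub_pos.2 hC) (Real.exp_pos _)
          linarith
        have h2 : ContinuousWithinAt x (Ioi t) t :=
          (hcont t (Ico_subset_Icc_self ht)).mono_of_mem_nhdsWithin
            (Icc_mem_nhdsGT_of_mem ht)
        filter_upwards [h2.norm.eventually_lt hcE.continuousWithinAt hlt] with s hs
        exact hs.le
    exact hsub (right_mem_Icc.2 hab)
  have h : ‖x b‖ * Real.exp (-((-lam + m * δ) * (b - a))) ≤ m * ‖x a‖ := by
    refine le_of_forall_gt_imp_ge_of_dense fun C hC => ?_
    calc _ ≤ C * Real.exp ((-lam + m * δ) * (b - a)) *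
            Real.exp (-((-lam + m * δ) * (b - a))) := by gcongr; exact key C hC
      _ = C := by rw [mul_assoc, ← Real.exp_add]; simp
  calc ‖x b‖ = ‖x b‖ * Real.exp (-((-lam + m * δ) * (b - a))) *
        Real.exp ((-lam + m * δ) * (b - a)) := by rw [mul_assoc, ← Real.exp_add]; simp
    _ ≤ m * ‖x a‖ * Real.exp ((-lam + m * δ) * (b - a)) := by gcongr
    _ = _ := by ring

/-- Exponential decay for a slowly varying linear system. On a time window of length
`T = 4 log m / lam` the coefficient is frozen at the midpoint, which leaves the rate `lam / 2`;
over a full window the gain `e^{-lam T / 2} = m⁻²` beats the overshoot `m`. -/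
theorem norm_le_of_slowly_varying {𝒜 : ℝ → X →L[ℝ] X} {m lam r τ : ℝ} (hm : 1 < m)
    (hlam : 0 < lam) (hr : 0 ≤ r) (hslow : 4 * m * Real.log m * r ≤ lam ^ 2)
    (hA : ∀ t ∈ Icc 0 τ, ExpBound (𝒜 t) m lam)
    (hvar : ∀ s ∈ Icc 0 τ, ∀ t ∈ Icc 0 τ, ‖𝒜 t - 𝒜 s‖ ≤ r * |t - s|)
    {x : ℝ → X} (hx : ∀ t ∈ Icc 0 τ, HasDerivWithinAt x (𝒜 t (x t)) (Icc 0 τ) t) (hτ : 0 ≤ τ) :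
    ‖x τ‖ ≤ m * Real.exp (-(lam / 4) * τ) * ‖x 0‖ := by
  have hlog : 0 < Real.log m := Real.log_pos hm
  have hm0 : 0 < m := by linarith
  set T := 4 * Real.log m / lam with hT
  have hT0 : 0 < T := by positivity
  have hrate : m * (r * (T / 2)) ≤ lam / 2 := by
    rw [hT]
    have : m * (r * (4 * Real.log m / lam / 2)) = (4 * m * Real.log m * r) / (2 * lam) := by
      field_simp
    rw [this, div_le_iff₀ (by positivity)]
    linarith
  have window : ∀ a ∈ Icc 0 τ, ∀ b ∈ Icc 0 τ, a ≤ b → b - a ≤ T →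
      ‖x b‖ ≤ m * Real.exp (-(lam / 2) * (b - a)) * ‖x a‖ := by
    intro a ha b hb hab hT'
    have hsub : Icc a b ⊆ Icc 0 τ := Icc_subset_Icc ha.1 hb.2
    have hmid : (a + b) / 2 ∈ Icc 0 τ := hsub ⟨by linarith, by linarith⟩
    have h := norm_le_of_norm_deriv_sub_le (hA _ hmid) hm.le hab
      (fun t ht => (hx t (hsub ht)).mono hsub) (δ := r * (T / 2)) (by positivity) (by
        intro t ht
        rw [← sub_apply]
        refine (𝒜 t - 𝒜 ((a + b) / 2)).le_of_opNorm_le ?_ _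
        refine (hvar _ hmid t (hsub ht)).trans ?_
        gcongr
        rw [abs_le]
        constructor <;> linarith [ht.1, ht.2])
    refine h.trans ?_
    gcongr
    · linarith
  have iter : ∀ n : ℕ, ∀ a ∈ Icc 0 τ, τ - a ≤ n * T →
      ‖x τ‖ ≤ m * Real.exp (-(lam / 4) * (τ - a)) * ‖x a‖ := by
    intro n
    induction n with
    | zero =>
      intro a ha h
      have : a = τ := le_antisymm ha.2 (by simpa using h)
      subst this
      simpa using le_mul_of_one_le_left (norm_nonneg (x a)) hm.le
    | succ n ih =>
      intro a ha h
      rcases le_total (τ - a) T with hle | hge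
      · refine (window a ha τ ⟨hτ, le_rfl⟩ ha.2 hle).trans ?_
        gcongr
        · linarith [ha.2]
        · linarith
      · have haT : a + T ∈ Icc 0 τ := ⟨by linarith [ha.1], by linarith⟩
        have h1 := ih (a + T) haT (by push_cast at h; linarith)
        have h2 := window a ha (a + T) haT (by linarith) (by linarith)
        have h3 : m * Real.exp (-(lam / 2) * (a + T - a)) = Real.exp (-(lam / 4) * T) := by
          have e1 : -(lam / 2) * (a + T - a) = -Real.log m + -Real.log m := by
            rw [hT]; field_simp; ring
          have e2 : -(lam / 4) * T = -Real.log m := by rw [hT]; field_simp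
          rw [e1, e2, Real.exp_add, Real.exp_neg, Real.exp_log hm0]
          field_simp
        rw [h3] at h2
        calc ‖x τ‖ ≤ m * Real.exp (-(lam / 4) * (τ - (a + T))) * ‖x (a + T)‖ := h1
          _ ≤ m * Real.exp (-(lam / 4) * (τ - (a + T))) *
                (Real.exp (-(lam / 4) * T) * ‖x a‖) := by gcongr
          _ = m * (Real.exp (-(lam / 4) * (τ - (a + T))) * Real.exp (-(lam / 4) * T)) *
                ‖x a‖ := by ring
          _ = _ := by rw [← Real.exp_add]; ring_nf
  obtain ⟨n, hn⟩ := exists_nat_ge (τ / T)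
  have := iter n 0 ⟨le_rfl, hτ⟩ (by rw [sub_zero]; exact (div_le_iff₀ hT0).1 hn)
  simpa using this

end SlowVariation

section Existence

/-! ### Global solutions for bounded Lipschitz vector fields -/

variable {X : Type*} [NormedAddCommGroup X] [NormedSpace ℝ X] [CompleteSpace X]

theorem exists_solution_Icc {g : X → X} {K M : NNReal} (hg : LipschitzWith K g)
    (hM : ∀ x, ‖g x‖ ≤ M) (x₀ : X) (T : NNReal) :
    ∃ x : ℝ → X, x 0 = x₀ ∧ ∀ t ∈ Icc (0 : ℝ) T, HasDerivWithinAt x (g (x t)) (Icc 0 T) t := by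
  have h : IsPicardLindelof (fun _ => g) (tmin := 0) (tmax := T) ⟨0, le_rfl, T.2⟩ x₀
      (M * T) 0 M K :=
    { lipschitzOnWith := fun _ _ => hg.lipschitzOnWith
      continuousOn := fun _ _ => continuousOn_const
      norm_le := fun _ _ x _ => hM x
      mul_max_le := by simp }
  exact h.exists_eq_forall_mem_Icc_hasDerivWithinAt₀

/-- Since the field is bounded, Picard–Lindelöf applies on every interval `[0, n]`; by uniqueness
the solutions fit together. -/
theorem exists_solution_Ici {g : X → X} {K M : NNReal} (hg : LipschitzWith K g)
    (hM : ∀ x, ‖g x‖ ≤ M) (x₀ : X) :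
    ∃ x : ℝ → X, x 0 = x₀ ∧ ∀ t ∈ Ici (0 : ℝ), HasDerivWithinAt x (g (x t)) (Ici 0) t := by
  choose y hy0 hy using fun n : ℕ => exists_solution_Icc hg hM x₀ n
  simp only [NNReal.coe_natCast] at hy
  have huniq : ∀ k n : ℕ, k ≤ n → EqOn (y k) (y n) (Icc 0 k) := by
    intro k n hkn
    have hsub : Icc (0 : ℝ) k ⊆ Icc 0 n := Icc_subset_Icc_right (by exact_mod_cast hkn)
    refine ODE_solution_unique (v := fun _ => g) (fun _ => hg)
      (fun t ht => (hy k t ht).continuousWithinAt) (fun t ht => ?_)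
      (fun t ht => ((hy n t (hsub ht)).mono hsub).continuousWithinAt) (fun t ht => ?_)
      ((hy0 k).trans (hy0 n).symm)
    · exact (hy k t (Ico_subset_Icc_self ht)).mono_of_mem_nhdsWithin (Icc_mem_nhdsGE_of_mem ht)
    · exact ((hy n t (hsub (Ico_subset_Icc_self ht))).mono hsub).mono_of_mem_nhdsWithin
        (Icc_mem_nhdsGE_of_mem ht)
  have hagree : ∀ n : ℕ, EqOn (fun t => y ⌈t⌉₊ t) (y n) (Icc 0 n) := fun n t ht =>
    huniq _ n (Nat.ceil_le.2 ht.2) ⟨ht.1, Nat.le_ceil t⟩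
  refine ⟨fun t => y ⌈t⌉₊ t, by simp [hy0], fun t ht => ?_⟩
  obtain ⟨n, hn⟩ := exists_nat_gt t
  have htn : t ∈ Icc (0 : ℝ) n := ⟨ht, hn.le⟩
  have h1 := (hy n t htn).congr (hagree n) (hagree n htn)
  rw [← hagree n htn] at h1
  refine h1.mono_of_mem_nhdsWithin ?_
  rw [← Ici_inter_Iic]
  exact inter_mem self_mem_nhdsWithin (mem_nhdsWithin_of_mem_nhds (Iic_mem_nhds hn))

end Existence

/-! ### The closed loop and its parameter -/

/-- The hypotheses on the closed loop over a neighbourhood `D` of the origin: Lipschitz dependence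
on the parameter, uniform exponential stability of the frozen systems, slow parameter variation. -/
structure SlowlyVarying (p : Coeffs) (K : Plane → ℝ) (D : Set Plane) (LA m lam : ℝ) : Prop where
  mem_nhds : D ∈ 𝓝 (0 : Plane)
  lip_pos : 0 < LA
  one_le : 1 ≤ m
  rate_pos : 0 < lam
  lip : ∀ θ ∈ paramSet p D, ∀ θ' ∈ paramSet p D, ‖Acl p K θ - Acl p K θ'‖ ≤ LA * ‖θ - θ'‖
  frozen : FrozenExpBound p K D m lam
  slow : ∀ ω ∈ velocitySet p K D, 4 * LA * m * Real.log m * ‖ω‖ < lam ^ 2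

variable {p : Coeffs} {K : Plane → ℝ} {D : Set Plane} {LA m lam LP c : ℝ}

theorem phi_mem_paramSet {x : Plane} (hx : x ∈ D) : phi p x ∈ paramSet p D := ⟨x, hx, rfl⟩

theorem paramSet_mono {D' : Set Plane} (h : D' ⊆ D) : paramSet p D' ⊆ paramSet p D :=
  fun _ ⟨x, hx, e⟩ => ⟨x, h hx, e⟩

theorem SlowlyVarying.mono (h : SlowlyVarying p K D LA m lam) {D' : Set Plane}
    (hD' : D' ∈ 𝓝 (0 : Plane)) (hsub : D' ⊆ D) : SlowlyVarying p K D' LA m lam where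
  mem_nhds := hD'
  lip_pos := h.lip_pos
  one_le := h.one_le
  rate_pos := h.rate_pos
  lip θ hθ θ' hθ' := h.lip θ (paramSet_mono hsub hθ) θ' (paramSet_mono hsub hθ')
  frozen θ hθ := h.frozen θ (paramSet_mono hsub hθ)
  slow ω hω := h.slow ω (by obtain ⟨x, hx, e⟩ := hω; exact ⟨x, hsub hx, e⟩)

theorem SlowlyVarying.zero_mem (h : SlowlyVarying p K D LA m lam) : (0 : Plane) ∈ D :=
  mem_of_mem_nhds h.mem_nhds

theorem SlowlyVarying.phi_zero_mem (h : SlowlyVarying p K D LA m lam) :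
    phi p 0 ∈ paramSet p D := phi_mem_paramSet h.zero_mem

theorem SlowlyVarying.expBound (h : SlowlyVarying p K D LA m lam) {θ : Plane}
    (hθ : θ ∈ paramSet p D) : ExpBound (Acl p K θ) m lam := by
  intro t ht
  have hm : 0 ≤ m := zero_le_one.trans h.one_le
  refine ContinuousLinearMap.opNorm_le_bound _ (by positivity) fun v => ?_
  have hs := h.frozen θ hθ (fun s => NormedSpace.exp (s • Acl p K θ) v) (fun s _ => ?_) t ht
  · rw [exp_zero_smul] at hs
    simpa using hs
  · have h1 := (hasDerivAt_exp_smul_const' (Acl p K θ) s).hasDerivWithinAt (s := Ici 0)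
    have h2 := h1.clm_apply (hasDerivWithinAt_const s (Ici 0) v)
    refine h2.congr_deriv ?_
    simp [mul_apply_eq_comp]

theorem Acl_apply_zero (θ x : Plane) :
    Acl p K θ x 0 = (θ 0 + K θ * (p.kα * p.M * p.dn)) * x 0 + x 1 := by
  simp [Acl, matAcl, matA, matB, matC, Matrix.mulVec, dotProduct,
    Fin.sum_univ_two]

theorem Acl_apply_one (θ x : Plane) :
    Acl p K θ x 1 = (θ 1 + K θ * (p.kq * p.M * p.dm)) * x 0 := by
  simp [Acl, matAcl, matA, matB, matC, Matrix.mulVec, dotProduct,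
    Fin.sum_univ_two]

/-- The overshoot constant cannot be `1`: the lower right entry of `Ã(θ)` vanishes, so along
`e^{t Ã(θ)} e₂` the norm has derivative zero at `t = 0`. -/
theorem SlowlyVarying.one_lt (h : SlowlyVarying p K D LA m lam) : 1 < m := by
  refine lt_of_le_of_ne h.one_le fun hm1 => ?_
  subst hm1
  have hA := h.expBound h.phi_zero_mem
  set A := Acl p K (phi p 0) with hAdef
  set e : Plane := !₂[0, 1] with he
  have hinner : inner ℝ e (A e) = 0 := by
    rw [EuclideanSpace.inner_eq_star_dotProduct]
    simp [dotProduct, Fin.sum_univ_two, hAdef, Acl_apply_one, he]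
  have hne : ‖e‖ = 1 := by simp [he, EuclideanSpace.norm_eq]
  set u : ℝ → ℝ := fun t => ‖NormedSpace.exp (t • A) e‖ ^ 2 - Real.exp (-(2 * lam) * t)
  have hu0 : u 0 = 0 := by simp [u, exp_zero_smul, hne]
  have hd : HasDerivAt u (2 * lam) 0 := by
    have h1 : HasDerivAt (fun t : ℝ => NormedSpace.exp (t • A) e) (A e) 0 := by
      have h2 := (hasDerivAt_exp_smul_const' A (0 : ℝ)).clm_apply (hasDerivAt_const (0 : ℝ) e)
      refine h2.congr_deriv ?_
      simp [exp_zero_smul]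
    have h3 := ((hasDerivAt_id (0 : ℝ)).const_mul (-(2 * lam))).exp
    refine (h1.norm_sq.sub h3).congr_deriv ?_
    simp [exp_zero_smul, hinner]
  have hle : ∀ t, 0 ≤ t → u t ≤ 0 := by
    intro t ht
    have h4 : ‖NormedSpace.exp (t • A) e‖ ≤ Real.exp (-lam * t) := by
      have := (NormedSpace.exp (t • A)).le_of_opNorm_le (hA t ht) e
      simpa [hne] using this
    have h5 : ‖NormedSpace.exp (t • A) e‖ ^ 2 ≤ Real.exp (-lam * t) ^ 2 := by gcongr
    have h6 : Real.exp (-lam * t) ^ 2 = Real.exp (-(2 * lam) * t) := by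
      rw [← Real.exp_nat_mul]; congr 1; push_cast; ring
    simp only [u]
    linarith
  have hslope := (hasDerivWithinAt_iff_tendsto_slope' (by simp)).1
    (hd.hasDerivWithinAt (s := Ioi (0 : ℝ)))
  have : 2 * lam ≤ 0 := le_of_tendsto hslope (by
    filter_upwards [self_mem_nhdsWithin] with t ht
    rw [slope_def_field, hu0]
    exact div_nonpos_of_nonpos_of_nonneg (by linarith [hle t (le_of_lt ht)])
      (by linarith [show (0 : ℝ) < t from ht]))
  linarith [h.rate_pos]

theorem alphaDot_eq (x : Plane) : alphaDot p K x = closedLoop p K x 0 := by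
  rw [closedLoop, Acl_apply_zero]
  simp [alphaDot, phi]
  ring

theorem closedLoop_zero : closedLoop p K 0 = 0 := map_zero _

/-- The chord direction of the quadratic curve `φ`: `φ(x) - φ(y)` is `x₀ - y₀` times this vector
at `s = x₀ + y₀`, and `ψ(x)` is `α̇` times this vector at `s = 2 x₀`. -/
noncomputable def chordVec (p : Coeffs) (s : ℝ) : Plane :=
  !₂[p.kα * p.M * (p.an * s + p.bn), p.kq * p.M * (p.am * s + p.bm)]

theorem continuous_chordVec : Continuous (chordVec p) := by
  unfold chordVec
  refine (PiLp.continuous_toLp 2 _).comp (continuous_pi fun i => ?_)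
  fin_cases i <;> simp <;> fun_prop

theorem phi_sub_phi (x y : Plane) :
    phi p x - phi p y = (x 0 - y 0) • chordVec p (x 0 + y 0) := by
  ext i
  fin_cases i <;> simp [phi, chordVec] <;> ring

theorem psi_eq (x : Plane) : psi p K x = alphaDot p K x • chordVec p (2 * x 0) := by
  ext i
  fin_cases i <;> simp [psi, chordVec] <;> ring

/-- Along the closed loop `θ̇ = ψ(x)`. -/
theorem hasDerivWithinAt_phi {x : ℝ → Plane} {s : Set ℝ} {t : ℝ}
    (hx : HasDerivWithinAt x (closedLoop p K (x t)) s t) :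
    HasDerivWithinAt (fun u => phi p (x u)) (psi p K (x t)) s t := by
  have h0 : HasDerivWithinAt (fun u => x u 0) (alphaDot p K (x t)) s t := by
    rw [alphaDot_eq]
    exact (EuclideanSpace.proj (𝕜 := ℝ) (0 : Fin 2)).hasFDerivAt.comp_hasDerivWithinAt t hx
  have h1 : HasDerivWithinAt (fun u => phi p (x t) + (x u 0 - x t 0) • chordVec p (x u 0 + x t 0))
      (psi p K (x t)) s t := by
    rw [hasDerivWithinAt_iff_tendsto_slope, psi_eq, two_mul]
    have h2 := hasDerivWithinAt_iff_tendsto_slope.1 h0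
    have h3 : Tendsto (fun u => chordVec p (x u 0 + x t 0)) (𝓝[s \ {t}] t)
        (𝓝 (chordVec p (x t 0 + x t 0))) :=
      (continuous_chordVec.tendsto _).comp
        ((h0.continuousWithinAt.tendsto.mono_left (nhdsWithin_mono _ sdiff_subset)).add_const _)
    refine (h2.smul h3).congr fun u => ?_
    simp [slope_def_module, smul_smul]
  refine h1.congr (fun u _ => ?_) ?_
  · rw [← phi_sub_phi]; abel
  · simp

theorem abs_apply_zero_le (x : Plane) : |x 0| ≤ ‖x‖ := by
  simpa using PiLp.norm_apply_le x 0

theorem exists_chordVec_bound (p : Coeffs) (R : ℝ) :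
    ∃ C > 0, ∀ s, |s| ≤ 2 * R → ‖chordVec p s‖ ≤ C := by
  obtain ⟨C, hC⟩ := (isCompact_Icc (a := -(2 * R)) (b := 2 * R)).exists_bound_of_continuousOn
    (continuous_chordVec (p := p)).continuousOn
  exact ⟨max C 1, by positivity, fun s hs => (hC s (abs_le.1 hs)).trans (le_max_left _ _)⟩

theorem exists_phi_lipschitz (p : Coeffs) (R : ℝ) :
    ∃ C > 0, ∀ x y : Plane, ‖x‖ ≤ R → ‖y‖ ≤ R → ‖phi p x - phi p y‖ ≤ C * ‖x - y‖ := by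
  obtain ⟨C, hC0, hC⟩ := exists_chordVec_bound p R
  refine ⟨C, hC0, fun x y hx hy => ?_⟩
  rw [phi_sub_phi, norm_smul, mul_comm, Real.norm_eq_abs]
  have h1 : |x 0 - y 0| ≤ ‖x - y‖ := by simpa using abs_apply_zero_le (x - y)
  have h2 : |x 0 + y 0| ≤ 2 * R :=
    (abs_add_le _ _).trans (by linarith [abs_apply_zero_le x, abs_apply_zero_le y])
  gcongr
  exact hC _ h2

theorem SlowlyVarying.exists_Acl_bound (h : SlowlyVarying p K D LA m lam) (R : ℝ) :
    ∃ a > 0, ∀ x ∈ D, ‖x‖ ≤ R → ‖Acl p K (phi p x)‖ ≤ a := by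
  obtain ⟨C, hC0, hC⟩ := exists_phi_lipschitz p R
  refine ⟨‖Acl p K (phi p 0)‖ + LA * (C * |R|) + 1, ?_, fun x hx hxR => ?_⟩
  · have := h.lip_pos
    positivity
  · have hR : 0 ≤ R := (norm_nonneg x).trans hxR
    have h1 := h.lip _ (phi_mem_paramSet hx) _ h.phi_zero_mem
    have h2 := hC x 0 hxR (by simpa using hR)
    rw [sub_zero] at h2
    have h3 : ‖phi p x - phi p 0‖ ≤ C * |R| := h2.trans (by gcongr; exact hxR.trans (le_abs_self _))
    have h4 : LA * ‖phi p x - phi p 0‖ ≤ LA * (C * |R|) := by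
      have := h.lip_pos
      gcongr
    have h5 := norm_le_insert' (Acl p K (phi p x)) (Acl p K (phi p 0))
    linarith

/-- The closed-loop field is Lipschitz on bounded parts of `D`. -/
theorem SlowlyVarying.exists_closedLoop_lipschitz (h : SlowlyVarying p K D LA m lam) (R : ℝ) :
    ∃ k : NNReal, LipschitzOnWith k (closedLoop p K) (D ∩ {x | ‖x‖ ≤ R}) := by
  obtain ⟨C, hC0, hC⟩ := exists_phi_lipschitz p R
  obtain ⟨a, ha0, ha⟩ := h.exists_Acl_bound R
  have hLA := h.lip_pos
  refine ⟨(a + LA * C * |R|).toNNReal, LipschitzOnWith.of_dist_le_mul ?_⟩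
  rintro x ⟨hx, hxR⟩ y ⟨hy, hyR⟩
  rw [Real.coe_toNNReal _ (by positivity), dist_eq_norm, dist_eq_norm]
  have h1 : closedLoop p K x - closedLoop p K y =
      Acl p K (phi p x) (x - y) + (Acl p K (phi p x) - Acl p K (phi p y)) y := by
    simp [closedLoop]
  have h2 := (Acl p K (phi p x)).le_of_opNorm_le (ha x hx hxR) (x - y)
  have h3 : ‖Acl p K (phi p x) - Acl p K (phi p y)‖ ≤ LA * (C * ‖x - y‖) :=
    (h.lip _ (phi_mem_paramSet hx) _ (phi_mem_paramSet hy)).trans (by gcongr; exact hC x y hxR hyR)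
  have h4 := (Acl p K (phi p x) - Acl p K (phi p y)).le_of_opNorm_le h3 y
  calc _ ≤ a * ‖x - y‖ + LA * (C * ‖x - y‖) * ‖y‖ := by
        rw [h1]; exact (norm_add_le _ _).trans (add_le_add h2 h4)
    _ ≤ a * ‖x - y‖ + LA * (C * ‖x - y‖) * |R| := by
        gcongr
        exact le_trans hyR (le_abs_self R)
    _ = _ := by ring

/-- `𝓗` is a neighbourhood of the origin because `α̇` is continuous there and `ψ(0) = 0`. -/
theorem SlowlyVarying.setH_mem_nhds (h : SlowlyVarying p K D LA m lam) (hLP : 0 < LP) :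
    setH p K D LP ∈ 𝓝 (0 : Plane) := by
  obtain ⟨k, hk⟩ := h.exists_closedLoop_lipschitz 1
  obtain ⟨C, hC0, hC⟩ := exists_chordVec_bound p 1
  have hlim : Tendsto (fun x : Plane => k * ‖x‖ * C) (𝓝 0) (𝓝 0) := by
    have : Continuous fun x : Plane => k * ‖x‖ * C := by fun_prop
    simpa using this.tendsto 0
  filter_upwards [h.mem_nhds, Metric.closedBall_mem_nhds (0 : Plane) one_pos,
    hlim.eventually_lt_const (inv_pos.2 hLP)] with x hxD hx1 hx
  have hx1' : ‖x‖ ≤ 1 := by simpa using hx1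
  refine ⟨hxD, lt_of_le_of_lt ?_ hx⟩
  rw [psi_eq, norm_smul, Real.norm_eq_abs, alphaDot_eq]
  have h1 := hk.dist_le_mul x ⟨hxD, hx1'⟩ 0 ⟨h.zero_mem, by simp⟩
  rw [closedLoop_zero, dist_zero_right, dist_zero_right] at h1
  gcongr
  · exact (abs_apply_zero_le _).trans h1
  · refine hC _ ?_
    rw [abs_mul, abs_two]
    linarith [abs_apply_zero_le x]

/-! ### Decay of trajectories in the domain -/

/-- A trajectory that stays in `D` decays exponentially, as the coefficient `Ã(φ(x(t)))` varies
slowly. -/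
theorem SlowlyVarying.norm_le_of_mem (h : SlowlyVarying p K D LA m lam) {x : ℝ → Plane} {τ : ℝ}
    (hτ : 0 ≤ τ) (hx : IsSolutionOn (closedLoop p K) x (Icc 0 τ)) (hD : ∀ t ∈ Icc 0 τ, x t ∈ D) :
    ‖x τ‖ ≤ m * Real.exp (-(lam / 4) * τ) * ‖x 0‖ := by
  have hm := h.one_lt
  have hlog := Real.log_pos hm
  have hLA := h.lip_pos
  have hlam := h.rate_pos
  set ρ := lam ^ 2 / (4 * LA * m * Real.log m) with hρ
  have hρ0 : 0 ≤ ρ := by positivity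
  have hψ : ∀ t ∈ Icc 0 τ, ‖psi p K (x t)‖ ≤ ρ := fun t ht => by
    rw [hρ, le_div_iff₀ (by positivity), mul_comm]
    exact (h.slow _ ⟨x t, hD t ht, rfl⟩).le
  have hφ : ∀ s ∈ Icc 0 τ, ∀ t ∈ Icc 0 τ, ‖phi p (x t) - phi p (x s)‖ ≤ ρ * |t - s| :=
    fun s hs t ht => (convex_Icc 0 τ).norm_image_sub_le_of_norm_hasDerivWithin_le
      (fun u hu => hasDerivWithinAt_phi (hx u hu)) hψ hs ht
  refine norm_le_of_slowly_varying (𝒜 := fun t => Acl p K (phi p (x t))) (r := LA * ρ) hm hlam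
    (by positivity) ?_ (fun t ht => h.expBound (phi_mem_paramSet (hD t ht))) ?_ hx hτ
  · rw [hρ]
    exact le_of_eq (by field_simp)
  · intro s hs t ht
    refine (h.lip _ (phi_mem_paramSet (hD t ht)) _ (phi_mem_paramSet (hD s hs))).trans ?_
    rw [mul_assoc]
    gcongr
    exact hφ s hs t ht

/-! ### The Lyapunov function -/

/-- The Lyapunov function `V(x) = xᵀ P(φ(x)) x` of the closed loop. -/
noncomputable def lyapV (p : Coeffs) (K : Plane → ℝ) (x : Plane) : ℝ :=
  inner ℝ x (lyapP p K (phi p x) x)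

theorem SlowlyVarying.norm_lyapP_le (h : SlowlyVarying p K D LA m lam) {θ : Plane}
    (hθ : θ ∈ paramSet p D) : ‖lyapP p K θ‖ ≤ m ^ 2 / (2 * lam) :=
  norm_lyapOp_le h.rate_pos (h.expBound hθ)

theorem SlowlyVarying.exists_isLipConstP (h : SlowlyVarying p K D LA m lam) :
    ∃ LP, IsLipConstP p K D LP := by
  have hm : 0 < m := one_pos.trans_le h.one_le
  have hLA := h.lip_pos
  have hlam := h.rate_pos
  refine ⟨2 * m ^ 3 / lam ^ 2 * LA, by positivity, fun θ hθ θ' hθ' => ?_⟩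
  refine (norm_lyapOp_sub_le hlam hm.le (h.expBound hθ) (h.expBound hθ')).trans ?_
  rw [mul_assoc]
  gcongr
  exact h.lip θ hθ θ' hθ'

theorem continuous_phi : Continuous (phi p) := by
  unfold phi
  refine (PiLp.continuous_toLp 2 _).comp (continuous_pi fun i => ?_)
  fin_cases i <;> simp <;> fun_prop

theorem IsLipConstP.continuousOn_lyapP (hLP : IsLipConstP p K D LP) :
    ContinuousOn (fun x => lyapP p K (phi p x)) D := by
  have h1 : LipschitzOnWith LP.toNNReal (lyapP p K) (paramSet p D) :=
    LipschitzOnWith.of_dist_le_mul fun θ hθ θ' hθ' => by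
      rw [Real.coe_toNNReal _ hLP.1.le, dist_eq_norm, dist_eq_norm]
      exact hLP.2 θ hθ θ' hθ'
  exact h1.continuousOn.comp continuous_phi.continuousOn fun x hx => phi_mem_paramSet hx

theorem IsLipConstP.continuousOn_lyapV (hLP : IsLipConstP p K D LP) :
    ContinuousOn (lyapV p K) D :=
  continuousOn_id.inner (hLP.continuousOn_lyapP.clm_apply continuousOn_id)

/-- `V` does not increase along trajectories in `𝓗`: with the parameter frozen its derivative is
`-‖x‖²`, and the variation of the parameter contributes at most `L_P ‖ψ(x)‖ ‖x‖²`. -/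
theorem SlowlyVarying.lyapV_le (h : SlowlyVarying p K D LA m lam) (hLP : IsLipConstP p K D LP)
    {x : ℝ → Plane} {τ : ℝ} (hτ : 0 ≤ τ) (hx : IsSolutionOn (closedLoop p K) x (Icc 0 τ))
    (hH : ∀ t ∈ Icc 0 τ, x t ∈ setH p K D LP) : lyapV p K (x τ) ≤ lyapV p K (x 0) := by
  have hcont : ContinuousOn x (Icc 0 τ) := fun t ht => (hx t ht).continuousWithinAt
  have hD : ∀ t ∈ Icc 0 τ, x t ∈ D := fun t ht => (hH t ht).1
  refine image_le_of_liminf_slope_right_le_deriv_boundary (f := fun t => lyapV p K (x t))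
    (B := fun _ => lyapV p K (x 0)) (B' := fun _ => 0) (hLP.continuousOn_lyapV.comp hcont hD) le_rfl
    continuousOn_const (fun t _ => hasDerivWithinAt_const _ _ _) ?_ (right_mem_Icc.2 hτ)
  intro t ht r hr
  have ht' := Ico_subset_Icc_self ht
  have hxd : HasDerivWithinAt x (closedLoop p K (x t)) (Ioi t) t :=
    (hx t ht').mono_of_mem_nhdsWithin (Icc_mem_nhdsGT_of_mem ht)
  set P := lyapP p K (phi p (x t)) with hP
  have h1 : HasDerivWithinAt (fun u => inner ℝ (x u) (P (x u))) (-‖x t‖ ^ 2) (Ioi t) t := by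
    refine (hxd.inner ℝ (P.hasFDerivAt.comp_hasDerivWithinAt t hxd)).congr_deriv ?_
    rw [add_comm]
    exact inner_lyapunov_equation h.rate_pos (h.expBound (phi_mem_paramSet (hD t ht'))) (x t)
  have hs1 := (hasDerivWithinAt_iff_tendsto_slope' (by simp)).1 h1
  have hs2 := (hasDerivWithinAt_iff_tendsto_slope' (by simp)).1 (hasDerivWithinAt_phi hxd)
  have hs3 := (hs2.norm.const_mul LP).mul (hxd.continuousWithinAt.tendsto.norm.pow 2)
  have hlim := hs1.add hs3
  have hneg : -‖x t‖ ^ 2 + LP * ‖psi p K (x t)‖ * ‖x t‖ ^ 2 < r := by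
    have h2 : LP * ‖psi p K (x t)‖ ≤ 1 := by
      have := mul_le_mul_of_nonneg_left (hH t ht').2.le hLP.1.le
      rwa [mul_inv_cancel₀ hLP.1.ne'] at this
    have h3 := mul_le_mul_of_nonneg_right h2 (sq_nonneg ‖x t‖)
    linarith
  refine Eventually.frequently ?_
  filter_upwards [hlim.eventually_lt_const hneg, self_mem_nhdsWithin,
    Ioo_mem_nhdsGT ht.2] with z hz hzt hzτ
  refine lt_of_le_of_lt ?_ hz
  have hzt : 0 < z - t := sub_pos.2 hzt
  have hz' : z ∈ Icc 0 τ := ⟨ht.1.trans hzτ.1.le, hzτ.2.le⟩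
  have hsplit : lyapV p K (x z) - lyapV p K (x t) = (inner ℝ (x z) (P (x z)) -
      inner ℝ (x t) (P (x t))) + inner ℝ (x z) ((lyapP p K (phi p (x z)) - P) (x z)) := by
    simp [lyapV, hP, inner_sub_right]
  have hbd : inner ℝ (x z) ((lyapP p K (phi p (x z)) - P) (x z)) ≤
      LP * ‖phi p (x z) - phi p (x t)‖ * ‖x z‖ ^ 2 := by
    have h4 := hLP.2 _ (phi_mem_paramSet (hD z hz')) _ (phi_mem_paramSet (hD t ht'))
    calc _ ≤ ‖x z‖ * (LP * ‖phi p (x z) - phi p (x t)‖ * ‖x z‖) :=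
          (real_inner_le_norm _ _).trans (by gcongr; exact ContinuousLinearMap.le_of_opNorm_le _ h4 _)
      _ = _ := by ring
  rw [slope_def_module, slope_def_module, slope_def_module, hsplit, smul_add, norm_smul, norm_inv,
    Real.norm_of_nonneg hzt.le, smul_eq_mul, smul_eq_mul]
  have h5 := mul_le_mul_of_nonneg_left hbd (inv_nonneg.2 hzt.le)
  calc _ ≤ (z - t)⁻¹ * (inner ℝ (x z) (P (x z)) - inner ℝ (x t) (P (x t))) +
        (z - t)⁻¹ * (LP * ‖phi p (x z) - phi p (x t)‖ * ‖x z‖ ^ 2) := by gcongr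
    _ = _ := by ring

/-! ### Invariance of the estimate -/

theorem isOpen_setW (θ : Plane) : IsOpen (setW p K c θ) :=
  isOpen_lt (continuous_id.inner (lyapP p K θ).continuous) continuous_const

theorem setL_subset_setW {θ : Plane} (hθ : θ ∈ paramSet p D) : setL p K D c ⊆ setW p K c θ :=
  fun _ hx => mem_iInter₂.1 hx θ hθ

theorem SlowlyVarying.setL_subset (h : SlowlyVarying p K D LA m lam)
    (hc : c ∈ admissibleLevels p K D LP) : setL p K D c ⊆ D :=
  fun _ hx => (hc.2 _ h.phi_zero_mem (setL_subset_setW h.phi_zero_mem hx)).1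

theorem inner_apply_self_sub_le (P : Plane →L[ℝ] Plane) (x y : Plane) :
    inner ℝ x (P x) - inner ℝ y (P y) ≤ ‖P‖ * (‖x - y‖ * (‖x‖ + ‖y‖)) := by
  have h1 : inner ℝ x (P x) - inner ℝ y (P y) = inner ℝ (x - y) (P x) + inner ℝ y (P (x - y)) := by
    simp only [map_sub, inner_sub_left, inner_sub_right]; ring
  have h2 : inner ℝ (x - y) (P x) ≤ ‖x - y‖ * (‖P‖ * ‖x‖) :=
    (real_inner_le_norm _ _).trans (by gcongr; exact P.le_opNorm x)
  have h3 : inner ℝ y (P (x - y)) ≤ ‖y‖ * (‖P‖ * ‖x - y‖) :=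
    (real_inner_le_norm _ _).trans (by gcongr; exact P.le_opNorm _)
  rw [h1]
  linarith

/-- For an admissible level `c`, a sublevel set `{x ∈ D : V(x) ≤ v}` with `v < c` is closed, even
though `D` need not be: a limit point lies in `𝓦(θ) ⊆ D` for a parameter `θ` of a nearby point. -/
theorem SlowlyVarying.isClosed_lyapV_le (h : SlowlyVarying p K D LA m lam)
    (hLP : IsLipConstP p K D LP) (hc : c ∈ admissibleLevels p K D LP) {v : ℝ} (hv : v < c) :
    IsClosed {x | x ∈ D ∧ lyapV p K x ≤ v} := by
  refine IsSeqClosed.isClosed fun y z hy hyz => ?_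
  have hlim : Tendsto (fun n => v + m ^ 2 / (2 * lam) * (‖z - y n‖ * (‖z‖ + ‖y n‖))) atTop
      (𝓝 v) := by
    have h1 := ((hyz.const_sub z).norm.mul (hyz.norm.const_add ‖z‖)).const_mul (m ^ 2 / (2 * lam))
    simpa using h1.const_add v
  obtain ⟨n, hn⟩ := (hlim.eventually_lt_const hv).exists
  have hθ : phi p (y n) ∈ paramSet p D := phi_mem_paramSet (hy n).1
  have hzW : z ∈ setW p K c (phi p (y n)) := by
    have h2 := inner_apply_self_sub_le (lyapP p K (phi p (y n))) z (y n)
    have h3 : ‖lyapP p K (phi p (y n))‖ * (‖z - y n‖ * (‖z‖ + ‖y n‖)) ≤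
        m ^ 2 / (2 * lam) * (‖z - y n‖ * (‖z‖ + ‖y n‖)) := by
      gcongr
      exact h.norm_lyapP_le hθ
    have h4 : lyapV p K (y n) ≤ v := (hy n).2
    change inner ℝ z (lyapP p K (phi p (y n)) z) < c
    rw [lyapV] at h4
    linarith
  have hzD : z ∈ D := (hc.2 _ hθ hzW).1
  refine ⟨hzD, ?_⟩
  have h5 : Tendsto y atTop (𝓝[D] z) :=
    tendsto_nhdsWithin_iff.2 ⟨hyz, Eventually.of_forall fun n => (hy n).1⟩
  exact le_of_tendsto ((hLP.continuousOn_lyapV z hzD).tendsto.comp h5)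
    (Eventually.of_forall fun n => (hy n).2)

/-- Trajectories starting in `𝓛` remain in `D` and decay. The field `g` need only agree with the
closed loop on a bounded part of `D` that the decay estimate does not let them leave. -/
theorem SlowlyVarying.invariance (h : SlowlyVarying p K D LA m lam) (hLP : IsLipConstP p K D LP)
    (hc : c ∈ admissibleLevels p K D LP) {g : Plane → Plane} {x : ℝ → Plane} {τ R : ℝ}
    (hx : IsSolutionOn g x (Icc 0 τ)) (hg : ∀ y ∈ D, ‖y‖ ≤ R → g y = closedLoop p K y)
    (h0 : x 0 ∈ setL p K D c) (hR : m * ‖x 0‖ < R) :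
    ∀ t ∈ Icc 0 τ, x t ∈ D ∧ ‖x t‖ ≤ m * ‖x 0‖ := by
  have hcont : ContinuousOn x (Icc 0 τ) := fun t ht => (hx t ht).continuousWithinAt
  have h0D : x 0 ∈ D := h.setL_subset hc h0
  have hv : lyapV p K (x 0) < c := setL_subset_setW (phi_mem_paramSet h0D) h0
  have hW : ∀ y ∈ D, lyapV p K y ≤ lyapV p K (x 0) → y ∈ setW p K c (phi p y) :=
    fun y _ hy => lt_of_le_of_lt hy hv
  have key : Icc 0 τ ⊆ x ⁻¹' ({y | y ∈ D ∧ lyapV p K y ≤ lyapV p K (x 0)} ∩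
      Metric.closedBall 0 (m * ‖x 0‖)) := by
    refine IsClosed.Icc_subset_of_forall_mem_nhdsGT_of_Icc_subset ?_ ?_ ?_
    · rw [inter_comm]
      exact hcont.preimage_isClosed_of_isClosed isClosed_Icc
        ((h.isClosed_lyapV_le hLP hc hv).inter Metric.isClosed_closedBall)
    · exact ⟨⟨h0D, le_rfl⟩, by simpa using le_mul_of_one_le_left (norm_nonneg _) h.one_le⟩
    · intro t ht hsub
      obtain ⟨⟨htD, htV⟩, htR⟩ := hsub (right_mem_Icc.2 ht.1)
      have hxt : ContinuousWithinAt x (Ioi t) t :=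
        (hcont t (Ico_subset_Icc_self ht)).mono_of_mem_nhdsWithin (Icc_mem_nhdsGT_of_mem ht)
      have hopen : ∀ᶠ z in 𝓝[>] t, x z ∈ setW p K c (phi p (x t)) ∩ Metric.ball 0 R :=
        hxt.eventually_mem (((isOpen_setW _).inter Metric.isOpen_ball).mem_nhds
          ⟨hW _ htD htV, Metric.closedBall_subset_ball hR htR⟩)
      obtain ⟨u, htu, hu⟩ := mem_nhdsGT_iff_exists_Ioo_subset.1 hopen
      filter_upwards [Ioo_mem_nhdsGT htu, Ioo_mem_nhdsGT ht.2] with z hzu hzτ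
      have hz0 : 0 ≤ z := ht.1.trans hzu.1.le
      have hsubz : Icc 0 z ⊆ Icc 0 τ := Icc_subset_Icc_right hzτ.2.le
      have hall : ∀ s ∈ Icc 0 z, x s ∈ setH p K D LP ∧ ‖x s‖ ≤ R := by
        intro s hs
        rcases le_or_gt s t with hst | hst
        · obtain ⟨⟨hsD, hsV⟩, hsR⟩ := hsub ⟨hs.1, hst⟩
          refine ⟨hc.2 _ (phi_mem_paramSet hsD) (hW _ hsD hsV), ?_⟩
          exact (by simpa using hsR : ‖x s‖ ≤ m * ‖x 0‖).trans hR.le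
        · obtain ⟨hsW, hsR⟩ := hu ⟨hst, hs.2.trans_lt hzu.2⟩
          refine ⟨hc.2 _ (phi_mem_paramSet htD) hsW, ?_⟩
          exact (by simpa using hsR : ‖x s‖ < R).le
      have hsol : IsSolutionOn (closedLoop p K) x (Icc 0 z) := fun s hs => by
        rw [← hg _ (hall s hs).1.1 (hall s hs).2]
        exact (hx s (hsubz hs)).mono hsubz
      refine ⟨⟨(hall z (right_mem_Icc.2 hz0)).1.1,
        h.lyapV_le hLP hz0 hsol fun s hs => (hall s hs).1⟩, ?_⟩
      have h1 := h.norm_le_of_mem hz0 hsol fun s hs => (hall s hs).1.1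
      have h2 : Real.exp (-(lam / 4) * z) ≤ 1 := Real.exp_le_one_iff.2 (by
        have := h.rate_pos
        have : 0 ≤ lam / 4 * z := by positivity
        linarith)
      have h3 : m * Real.exp (-(lam / 4) * z) * ‖x 0‖ ≤ m * 1 * ‖x 0‖ := by
        have := h.one_le
        gcongr
      simpa using h1.trans h3
  intro t ht
  obtain ⟨⟨h1, _⟩, h2⟩ := key ht
  exact ⟨h1, by simpa using h2⟩

/-! ### Existence of trajectories -/

/-- A bounded Lipschitz map on a subset extends to a bounded Lipschitz map: extend coordinatewise
and clamp the values. -/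
theorem exists_bounded_lipschitz_extension {f : Plane → Plane} {S : Set Plane} {k : NNReal}
    (hf : LipschitzOnWith k f S) {M : ℝ} (hM : ∀ y ∈ S, ‖f y‖ ≤ M) (hM0 : 0 ≤ M) :
    ∃ (g : Plane → Plane) (k' M' : NNReal), LipschitzWith k' g ∧ (∀ y, ‖g y‖ ≤ M') ∧
      EqOn g f S := by
  have h1 := (PiLp.lipschitzWith_ofLp 2 (fun _ : Fin 2 => ℝ)).comp_lipschitzOnWith hf
  obtain ⟨G, hG, hGf⟩ := h1.extend_pi
  have hclamp : LipschitzWith 1 fun s : ℝ => max (-M) (min s M) :=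
    (LipschitzWith.id.min_const M).const_max (-M)
  have h2 : LipschitzWith (1 * k) fun y i => max (-M) (min (G y i) M) := by
    refine LipschitzWith.of_dist_le_mul fun x y => ?_
    refine (dist_pi_le_iff (by positivity)).2 fun i => ?_
    refine (hclamp.dist_le_mul _ _).trans ?_
    rw [NNReal.coe_one, one_mul]
    exact (dist_le_pi_dist _ _ i).trans (hG.dist_le_mul x y)
  obtain ⟨κ, hto⟩ : ∃ κ, LipschitzWith κ (WithLp.toLp 2 : (Fin 2 → ℝ) → Plane) :=
    ⟨_, PiLp.lipschitzWith_toLp 2 (fun _ : Fin 2 => ℝ)⟩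
  refine ⟨fun y => WithLp.toLp 2 fun i => max (-M) (min (G y i) M), _, κ * M.toNNReal,
    hto.comp h2, fun y => ?_, fun y hy => ?_⟩
  · have h3 := hto.dist_le_mul (fun i => max (-M) (min (G y i) M)) 0
    rw [WithLp.toLp_zero, dist_zero_right, dist_zero_right] at h3
    refine h3.trans ?_
    rw [NNReal.coe_mul, Real.coe_toNNReal _ hM0]
    gcongr
    refine (pi_norm_le_iff_of_nonneg hM0).2 fun i => ?_
    rw [Real.norm_eq_abs, abs_le]
    exact ⟨le_max_left _ _, max_le (by linarith) (min_le_right _ _)⟩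
  · ext i
    have h4 : f y i = G y i := congrFun (hGf hy) i
    have h5 : |f y i| ≤ M := by
      simpa using (PiLp.norm_apply_le (f y) i).trans (hM y hy)
    rw [abs_le] at h5
    simp [← h4, h5.1, h5.2]

theorem SlowlyVarying.exists_solution (h : SlowlyVarying p K D LA m lam)
    (hLP : IsLipConstP p K D LP) (hc : c ∈ admissibleLevels p K D LP) {x₀ : Plane}
    (hx₀ : x₀ ∈ setL p K D c) :
    ∃ x : ℝ → Plane, IsSolutionOn (closedLoop p K) x (Ici 0) ∧ x 0 = x₀ := by
  set R := m * ‖x₀‖ + 1 with hR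
  have hR0 : 0 ≤ R := by
    have := h.one_le
    positivity
  obtain ⟨k, hk⟩ := h.exists_closedLoop_lipschitz R
  obtain ⟨a, ha0, ha⟩ := h.exists_Acl_bound R
  obtain ⟨g, k', M', hg, hgM, hgf⟩ := exists_bounded_lipschitz_extension hk (M := a * R)
    (fun y hy => ((Acl p K (phi p y)).le_of_opNorm_le (ha y hy.1 hy.2) y).trans (by
      gcongr
      exact hy.2)) (by positivity)
  obtain ⟨x, hx0, hx⟩ := exists_solution_Ici hg hgM x₀
  refine ⟨x, fun t ht => ?_, hx0⟩
  have hinv := h.invariance hLP hc (g := g) (τ := t) (R := R)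
    (fun s hs => (hx s hs.1).mono Icc_subset_Ici_self) (fun y hy hyR => hgf ⟨hy, hyR⟩)
    (by rwa [hx0]) (by rw [hx0, hR]; linarith) t (right_mem_Icc.2 ht)
  have ht' : g (x t) = closedLoop p K (x t) := hgf ⟨hinv.1, by
    change ‖x t‖ ≤ R
    rw [hR, ← hx0]
    linarith [hinv.2]⟩
  rw [← ht']
  exact hx t ht

/-! ### Estimates of the region of attraction -/

theorem SlowlyVarying.mem_setW_of_norm_sq_lt (h : SlowlyVarying p K D LA m lam) {θ : Plane}
    (hθ : θ ∈ paramSet p D) {x : Plane} (hx : m ^ 2 / (2 * lam) * ‖x‖ ^ 2 < c) :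
    x ∈ setW p K c θ :=
  (inner_lyapOp_self_le h.rate_pos (h.expBound hθ) x).trans_lt hx

theorem SlowlyVarying.setL_mem_nhds (h : SlowlyVarying p K D LA m lam) (hc : 0 < c) :
    setL p K D c ∈ 𝓝 (0 : Plane) := by
  have hlim : Tendsto (fun x : Plane => m ^ 2 / (2 * lam) * ‖x‖ ^ 2) (𝓝 0) (𝓝 0) := by
    have : Continuous fun x : Plane => m ^ 2 / (2 * lam) * ‖x‖ ^ 2 := by fun_prop
    simpa using this.tendsto 0
  filter_upwards [hlim.eventually_lt_const hc] with x hx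
  exact mem_iInter₂.2 fun θ hθ => h.mem_setW_of_norm_sq_lt hθ hx

theorem SlowlyVarying.isAttractionEstimate (h : SlowlyVarying p K D LA m lam)
    (hLP : IsLipConstP p K D LP) (hc : c ∈ admissibleLevels p K D LP) :
    IsAttractionEstimate (closedLoop p K) D (setL p K D c) := by
  have hstay : ∀ (T : ℝ) (x : ℝ → Plane), IsSolutionOn (closedLoop p K) x (Ico 0 T) →
      x 0 ∈ setL p K D c → ∀ t ∈ Ico 0 T, x t ∈ D := fun T x hx h0 t ht =>
    (h.invariance hLP hc (τ := t) (R := m * ‖x 0‖ + 1)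
      (fun s hs => (hx s ⟨hs.1, hs.2.trans_lt ht.2⟩).mono (Icc_subset_Ico_right ht.2))
      (fun _ _ _ => rfl) h0 (by linarith) t (right_mem_Icc.2 ht.1)).1
  refine ⟨h.setL_subset hc, h.setL_mem_nhds hc.1, hstay, m, one_pos.trans_le h.one_le, lam / 4,
    div_pos h.rate_pos (by norm_num), fun x₀ hx₀ => ⟨h.exists_solution hLP hc hx₀, ?_⟩⟩
  intro T x hx hx0 t ht
  subst hx0
  exact h.norm_le_of_mem ht.1
    (fun s hs => (hx s ⟨hs.1, hs.2.trans_lt ht.2⟩).mono (Icc_subset_Ico_right ht.2))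
    fun s hs => hstay T x hx hx₀ s ⟨hs.1, hs.2.trans_lt ht.2⟩

/-! ### Admissible levels -/

/-- On a bounded domain the operators `P(θ)` are uniformly coercive, so that the sets `𝓦_c(θ)`
shrink to the origin uniformly in `θ` as `c → 0`. -/
theorem SlowlyVarying.admissibleLevels_nonempty (h : SlowlyVarying p K D LA m lam)
    (hD : Bornology.IsBounded D) (hLP : 0 < LP) : (admissibleLevels p K D LP).Nonempty := by
  obtain ⟨R, hR⟩ := hD.exists_norm_le
  obtain ⟨a, ha0, ha⟩ := h.exists_Acl_bound R
  obtain ⟨ε, hε, hball⟩ := Metric.mem_nhds_iff.1 (h.setH_mem_nhds hLP)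
  have hm : 0 < m := one_pos.trans_le h.one_le
  have hlam := h.rate_pos
  refine ⟨lam / (2 * a ^ 2 * m ^ 2) * ε ^ 2, by positivity, fun θ hθ x hx => hball ?_⟩
  obtain ⟨y, hy, rfl⟩ := hθ
  have h1 := (le_inner_lyapOp_self hlam (h.expBound (phi_mem_paramSet hy)) hm ha0
    (ha y hy (hR y hy)) x).trans_lt hx
  have h2 : ‖x‖ ^ 2 < ε ^ 2 := lt_of_mul_lt_mul_left h1 (by positivity)
  simpa using lt_of_pow_lt_pow_left₀ 2 hε.le h2

theorem SlowlyVarying.bddAbove_admissibleLevels (h : SlowlyVarying p K D LA m lam)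
    (hD : Bornology.IsBounded D) : BddAbove (admissibleLevels p K D LP) := by
  obtain ⟨R, hR⟩ := hD.exists_norm_le
  have hR0 : 0 ≤ R := (norm_nonneg _).trans (hR 0 h.zero_mem)
  refine ⟨m ^ 2 / (2 * lam) * (R + 1) ^ 2, fun c hc => ?_⟩
  by_contra! hlt
  -- a vector of norm `R + 1` lies in `𝓦_c` but not in `D`
  set x : Plane := EuclideanSpace.single 0 (R + 1) with hx
  have hxn : ‖x‖ = R + 1 := by simp [hx, abs_of_nonneg (by linarith : 0 ≤ R + 1)]
  have h1 := hc.2 _ h.phi_zero_mem (h.mem_setW_of_norm_sq_lt h.phi_zero_mem (by rwa [hxn]))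
  linarith [hR x h1.1]

/-- The supremum of the admissible levels is admissible, since `𝓦_c(θ)` is the union of the
`𝓦_b(θ)` over `b < c`. -/
theorem SlowlyVarying.exists_isGreatest_admissibleLevels (h : SlowlyVarying p K D LA m lam)
    (hD : Bornology.IsBounded D) (hLP : 0 < LP) :
    ∃ c, IsGreatest (admissibleLevels p K D LP) c := by
  have hne := h.admissibleLevels_nonempty hD hLP
  have hbdd := h.bddAbove_admissibleLevels (LP := LP) hD
  refine ⟨sSup (admissibleLevels p K D LP), ⟨?_, fun θ hθ x hx => ?_⟩, fun c hc => le_csSup hbdd hc⟩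
  · obtain ⟨c, hc⟩ := hne
    exact hc.1.trans_le (le_csSup hbdd hc)
  · obtain ⟨b, hb, hxb⟩ := exists_lt_of_lt_csSup hne hx
    exact hb.2 θ hθ hxb

/-- Restricting to a bounded neighbourhood provides an admissible level, hence an estimate. -/
theorem SlowlyVarying.exists_isAttractionEstimate (h : SlowlyVarying p K D LA m lam) :
    ∃ L, IsAttractionEstimate (closedLoop p K) D L := by
  have h' := h.mono (inter_mem h.mem_nhds (Metric.closedBall_mem_nhds 0 one_pos)) inter_subset_left
  obtain ⟨LP, hLP⟩ := h'.exists_isLipConstP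
  obtain ⟨c, hc⟩ := h'.admissibleLevels_nonempty
    (Metric.isBounded_closedBall.subset inter_subset_right) hLP.1
  have hL := h'.isAttractionEstimate hLP hc
  exact ⟨_, hL.subset.trans inter_subset_left, hL.mem_nhds,
    fun T x hx h0 t ht => (hL.stays T x hx h0 t ht).1, hL.converges⟩

end Missile

theorem mainTheorem5 (p : Missile.Coeffs)
    -- the gain `K(θ) = ϱ_K(θ, t̄_θ)`
    (η ϱ : MvPolynomial (Fin 3) ℝ) (tbar : Missile.Plane → ℝ)
    (K : Missile.Plane → ℝ) (hK : K = Missile.gain ϱ tbar)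
    -- the domain
    (D : Set Missile.Plane) (hD : D ∈ 𝓝 (0 : Missile.Plane))
    -- `t̄_θ` is a root of `η(θ, ·)`
    (hroot : ∀ θ ∈ Missile.paramSet p D, MvPolynomial.eval ![θ 0, θ 1, tbar θ] η = 0)
    (LA m lam : ℝ) (hLA : 0 < LA) (hm : 1 ≤ m) (hlam : 0 < lam)
    -- `Ã` is Lipschitz on `𝓔`
    (hLip : ∀ θ ∈ Missile.paramSet p D, ∀ θ' ∈ Missile.paramSet p D,
      ‖Missile.Acl p K θ - Missile.Acl p K θ'‖ ≤ LA * ‖θ - θ'‖)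
    -- uniform exponential bound for the frozen systems
    (hexp : Missile.FrozenExpBound p K D m lam)
    -- slow variation: `‖ω‖ < lam² / (4 LA m log m)`, no condition if `m = 1`
    (hslow : ∀ ω ∈ Missile.velocitySet p K D, 4 * LA * m * Real.log m * ‖ω‖ < lam ^ 2) :
    Missile.ExpStableAtZero (Missile.closedLoop p K) ∧
    (∃ L : Set Missile.Plane, Missile.IsAttractionEstimate (Missile.closedLoop p K) D L) ∧
    (∃ LP : ℝ, Missile.IsLipConstP p K D LP) ∧
    ∀ LP : ℝ, Missile.IsLipConstP p K D LP →
      (∀ c ∈ Missile.admissibleLevels p K D LP,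
        Missile.IsAttractionEstimate (Missile.closedLoop p K) D (Missile.setL p K D c)) ∧
      (Bornology.IsBounded D → ∃ c : ℝ, IsGreatest (Missile.admissibleLevels p K D LP) c) := by
  have h : Missile.SlowlyVarying p K D LA m lam := ⟨hD, hLA, hm, hlam, hLip, hexp, hslow⟩
  obtain ⟨L, hL⟩ := h.exists_isAttractionEstimate
  exact ⟨⟨Missile.closedLoop_zero, L, hL.mem_nhds, hL.converges⟩, ⟨L, hL⟩, h.exists_isLipConstP,
    fun LP hLP => ⟨fun c hc => h.isAttractionEstimate hLP hc,
      fun hB => h.exists_isGreatest_admissibleLevels hB hLP.1⟩⟩
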